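/- Let $n\ge 0$ be an integer, let $\mathbf C^+=\{\omega\in\mathbf C:\operatorname{Im}\omega>0\}$, and let $\mathcal H^n$ be the space of symmetric complex $n\times n$ matrices $M$ whose entrywise imaginary part $\operatorname{Im}M$ is positive definite. Let $K$ be a compact topological space and let $F\colon K\times\mathbf C^+\to\mathcal H^n$ be a continuous map such that $\omega\mapsto F(u,\omega)$ is holomorphic on $\mathbf C^+$ for each $u\in K$. Put $U_1=\{\omega=x+iy\in\mathbf C: -1<x<1,\ y\ge 1\}$ and $F'=\partial F/\partial\omega$. Then there are constants $C_1>0$ and $C_2$, which may depend on $F$ but not on $(u,\omega)$, such that for all $u\in K$ and all $\omega=x+iy\in U_1$ $$\det\operatorname{Im}F(u,\omega)\ \ge\ C_1\,y^{-n}\qquad\text{and}\qquad |\det F'(u,\omega)|\ \le\ C_2 .$$ -/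

import Mathlib

/-- The space of symmetric complex `n × n` matrices whose (entrywise) imaginary part is a
positive definite real matrix. -/
def siegelUpperHalfSpace (n : ℕ) : Set (Matrix (Fin n) (Fin n) ℂ) :=
  {M | M.IsSymm ∧ (M.map Complex.im).PosDef}

/-- The half-strip `{x + i y : -1 < x < 1, 1 ≤ y}`. -/
def halfStrip : Set ℂ := {ω | -1 < ω.re ∧ ω.re < 1 ∧ 1 ≤ ω.im}

/-- A matrix-valued function of one complex variable is holomorphic on `U`
if each of its entries is. -/
def MatrixHolomorphicOn {n : ℕ} (G : ℂ → Matrix (Fin n) (Fin n) ℂ) (U : Set ℂ) : Prop :=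
  ∀ i j, DifferentiableOn ℂ (fun ω => G ω i j) U

/-- The entrywise complex derivative of a matrix-valued function. -/
noncomputable def matrixDeriv {n : ℕ} (G : ℂ → Matrix (Fin n) (Fin n) ℂ) (ω : ℂ) :
    Matrix (Fin n) (Fin n) ℂ :=
  Matrix.of fun i j => deriv (fun w => G w i j) ω

/-! For real `v ≠ 0` the scalar function `vᵀ F(u, ω) v` is a holomorphic self-map of the upper
half-plane. Schwarz–Pick compares it with its value at `i`: on the half-strip its imaginary part
drops at most like `1/(5y)`, and its derivative is at most `5` times the imaginary part at `i`.
Compactness of `K` and of the unit sphere makes these bounds uniform. The first bounds the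
eigenvalues of `Im F` from below; the second, by polarization, bounds the entries of the symmetric
matrix `F'`. -/

open UpperHalfPlane hiding I in
open Complex in
/-- The **Schwarz–Pick inequality** for holomorphic self-maps of the upper half-plane. -/
theorem norm_sub_mul_le_of_mapsTo_upperHalfPlaneSet {f : ℂ → ℂ}
    (hf : DifferentiableOn ℂ f upperHalfPlaneSet)
    (hmaps : Set.MapsTo f upperHalfPlaneSet upperHalfPlaneSet)
    {a w : ℂ} (ha : 0 < a.im) (hw : 0 < w.im) :
    ‖f w - f a‖ * ‖w - star a‖ ≤ ‖f w - star (f a)‖ * ‖w - a‖ := by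
  have sub_star_ne {b z : ℂ} (hb : 0 < b.im) (hz : 0 < z.im) : z - star b ≠ 0 := by
    intro h
    have := congrArg Complex.im h
    simp at this
    linarith
  have norm_lt {b z : ℂ} (hb : 0 < b.im) (hz : 0 < z.im) : ‖(z - b) / (z - star b)‖ < 1 := by
    rw [norm_div, div_lt_one (norm_pos_iff.2 (sub_star_ne hb hz))]
    refine lt_of_pow_lt_pow_left₀ 2 (norm_nonneg _) ?_
    simp only [Complex.sq_norm, Complex.normSq_apply, Complex.sub_re, Complex.sub_im,
      Complex.star_def, Complex.conj_re, Complex.conj_im]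
    nlinarith [mul_pos hb hz]
  -- Inverse Cayley transform, from the disc to the half-plane with `0 ↦ a`; conjugating `f` by such
  -- maps reduces the claim to the Schwarz lemma.
  set φ : ℂ → ℂ := fun z => (a - star a * z) / (1 - z) with hφ
  have one_sub_ne {z : ℂ} (hz : z ∈ Metric.ball (0 : ℂ) 1) : 1 - z ≠ 0 := by
    intro h
    rw [mem_ball_zero_iff, ← sub_eq_zero.1 h] at hz
    simp at hz
  have hφmaps : Set.MapsTo φ (Metric.ball 0 1) upperHalfPlaneSet := by
    intro z hz
    have h1 := one_sub_ne hz
    have h2 : ‖z‖ ^ 2 < 1 := by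
      rw [mem_ball_zero_iff] at hz
      nlinarith [norm_nonneg z]
    rw [Complex.sq_norm, Complex.normSq_apply] at h2
    have h3 : 0 < Complex.normSq (1 - z) := Complex.normSq_pos.2 h1
    have h4 : (φ z).im = a.im * (1 - (z.re * z.re + z.im * z.im)) / Complex.normSq (1 - z) := by
      simp only [hφ, Complex.div_im]
      simp
      ring
    change 0 < (φ z).im
    rw [h4]
    exact div_pos (mul_pos ha (by linarith)) h3
  have hφdiff : DifferentiableOn ℂ φ (Metric.ball 0 1) := by
    refine DifferentiableOn.div (by fun_prop) (by fun_prop) fun z hz => one_sub_ne hz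
  have hcomp : DifferentiableOn ℂ (fun z => f (φ z)) (Metric.ball 0 1) := hf.comp hφdiff hφmaps
  set g : ℂ → ℂ := fun z => (f (φ z) - f a) / (f (φ z) - star (f a)) with hg
  have hgdiff : DifferentiableOn ℂ g (Metric.ball 0 1) :=
    (hcomp.sub_const _).div (hcomp.sub_const _) fun z hz =>
      sub_star_ne (hmaps ha) (hmaps (hφmaps hz))
  have hgmaps : Set.MapsTo g (Metric.ball 0 1) (Metric.closedBall 0 1) := fun z hz => by
    rw [mem_closedBall_zero_iff]
    exact (norm_lt (hmaps ha) (hmaps (hφmaps hz))).le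
  have hg0 : g 0 = 0 := by simp [hg, hφ]
  have hwa := sub_star_ne ha hw
  have haa := sub_star_ne ha ha
  have hφw : φ ((w - a) / (w - star a)) = w := by
    have : 1 - (w - a) / (w - star a) = (a - star a) / (w - star a) := by
      field_simp
      ring
    simp only [hφ]
    rw [this]
    field_simp
    ring
  have key := Complex.norm_le_norm_of_mapsTo_ball hgdiff hgmaps hg0 (norm_lt ha hw)
  simp only [hg, hφw, norm_div] at key
  rwa [div_le_div_iff₀ (norm_pos_iff.2 (sub_star_ne (hmaps ha) (hmaps hw)))
    (norm_pos_iff.2 hwa), mul_comm ‖w - a‖] at key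

open UpperHalfPlane hiding I in
open Complex in
/-- The infinitesimal Schwarz–Pick inequality. -/
theorem norm_deriv_mul_im_le_of_mapsTo_upperHalfPlaneSet {f : ℂ → ℂ}
    (hf : DifferentiableOn ℂ f upperHalfPlaneSet)
    (hmaps : Set.MapsTo f upperHalfPlaneSet upperHalfPlaneSet) {a : ℂ} (ha : 0 < a.im) :
    ‖deriv f a‖ * a.im ≤ (f a).im := by
  have hnhds := isOpen_upperHalfPlaneSet.mem_nhds ha
  have hd : HasDerivAt f (deriv f a) a := (hf.differentiableAt hnhds).hasDerivAt
  have h1 : Filter.Tendsto (fun w => ‖slope f a w‖ * ‖w - star a‖) (nhdsWithin a {a}ᶜ)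
      (nhds (‖deriv f a‖ * ‖a - star a‖)) := by
    refine (hasDerivAt_iff_tendsto_slope.1 hd).norm.mul ?_
    exact (Continuous.tendsto (by fun_prop) a).mono_left nhdsWithin_le_nhds
  have h2 : Filter.Tendsto (fun w => ‖f w - star (f a)‖) (nhdsWithin a {a}ᶜ)
      (nhds ‖f a - star (f a)‖) :=
    ((hd.continuousAt.tendsto.sub_const _).norm).mono_left nhdsWithin_le_nhds
  have h3 := le_of_tendsto_of_tendsto h1 h2 (by
    filter_upwards [self_mem_nhdsWithin, nhdsWithin_le_nhds hnhds] with w hw hw'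
    have hpos : 0 < ‖w - a‖ := norm_pos_iff.2 (sub_ne_zero.2 hw)
    have := norm_sub_mul_le_of_mapsTo_upperHalfPlaneSet hf hmaps ha hw'
    rw [slope_def_field, norm_div, div_mul_eq_mul_div, div_le_iff₀ hpos]
    exact this)
  have hn {z : ℂ} (hz : 0 < z.im) : ‖z - star z‖ = 2 * z.im := by
    rw [Complex.star_def, Complex.sub_conj]
    simp [abs_of_pos hz]
  rw [hn ha, hn (hmaps ha)] at h3
  linarith

theorem im_pos_of_mem_halfStrip {ω : ℂ} (hω : ω ∈ halfStrip) : 0 < ω.im :=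
  zero_lt_one.trans_le hω.2.2

open UpperHalfPlane hiding I in
open Complex in
/-- A Harnack inequality on the half-strip, with base point `i`. -/
theorem im_add_sq_le_of_mem_halfStrip {f : ℂ → ℂ}
    (hf : DifferentiableOn ℂ f upperHalfPlaneSet)
    (hmaps : Set.MapsTo f upperHalfPlaneSet upperHalfPlaneSet) {ω : ℂ} (hω : ω ∈ halfStrip) :
    ((f ω).im + (f I).im) ^ 2 ≤ 5 * ω.im * ((f ω).im * (f I).im) := by
  have hy := im_pos_of_mem_halfStrip hω
  have hI : 0 < I.im := by simp
  have h := pow_le_pow_left₀ (by positivity)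
    (norm_sub_mul_le_of_mapsTo_upperHalfPlaneSet hf hmaps hI hy) 2
  have hs : 0 < (f ω).im := hmaps hy
  have ht : 0 < (f I).im := hmaps hI
  simp only [mul_pow, Complex.sq_norm, Complex.normSq_apply, Complex.sub_re, Complex.sub_im,
      Complex.star_def, Complex.conj_re, Complex.conj_im, Complex.I_re, Complex.I_im] at h
  obtain ⟨h1, h2, h3⟩ := hω
  set s := (f ω).im
  set t := (f I).im
  set d := (f ω).re - (f I).re
  set x := ω.re
  set y := ω.im
  have hst : 0 < s * t := mul_pos hs ht
  -- With `A = d² + (s+t)²` and `B = x² + (y+1)²`, `h` reads `(A - 4st) B ≤ A (B - 4y)`, that is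
  -- `4yA ≤ 4stB`; then `d²` is dropped.
  have e1 : 4 * y * (s + t) ^ 2 ≤ 4 * (s * t) * (x ^ 2 + (y + 1) ^ 2) := by
    nlinarith [mul_nonneg hy.le (sq_nonneg d)]
  -- Source of the constant 5: `|x| < 1 ≤ y` gives `x² ≤ y²` and `(y+1)² ≤ 4y²`.
  have e2 : x ^ 2 + (y + 1) ^ 2 ≤ 5 * y ^ 2 := by nlinarith
  have e3 : y * (s + t) ^ 2 ≤ y * (5 * y * (s * t)) := by nlinarith
  exact le_of_mul_le_mul_left e3 hy

open UpperHalfPlane hiding I in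
open Complex in
theorem im_I_le_of_mem_halfStrip {f : ℂ → ℂ} (hf : DifferentiableOn ℂ f upperHalfPlaneSet)
    (hmaps : Set.MapsTo f upperHalfPlaneSet upperHalfPlaneSet) {ω : ℂ} (hω : ω ∈ halfStrip) :
    (f I).im ≤ 5 * ω.im * (f ω).im := by
  have h := im_add_sq_le_of_mem_halfStrip hf hmaps hω
  have hs : 0 < (f ω).im := hmaps (im_pos_of_mem_halfStrip hω)
  have ht : 0 < (f I).im := hmaps (show 0 < I.im by simp)
  refine le_of_mul_le_mul_right ?_ ht
  nlinarith

-- Harnack lets `Im f` grow at most linearly in `y`, which cancels the factor `y` in the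
-- infinitesimal Schwarz–Pick inequality.
open UpperHalfPlane hiding I in
open Complex in
theorem norm_deriv_le_of_mem_halfStrip {f : ℂ → ℂ} (hf : DifferentiableOn ℂ f upperHalfPlaneSet)
    (hmaps : Set.MapsTo f upperHalfPlaneSet upperHalfPlaneSet) {ω : ℂ} (hω : ω ∈ halfStrip) :
    ‖deriv f ω‖ ≤ 5 * (f I).im := by
  have h := im_add_sq_le_of_mem_halfStrip hf hmaps hω
  have hy := im_pos_of_mem_halfStrip hω
  have hs : 0 < (f ω).im := hmaps hy
  have ht : 0 < (f I).im := hmaps (show 0 < I.im by simp)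
  have hd := norm_deriv_mul_im_le_of_mapsTo_upperHalfPlaneSet hf hmaps hy
  have h1 : (f ω).im ≤ 5 * ω.im * (f I).im := by
    refine le_of_mul_le_mul_right ?_ hs
    nlinarith
  refine le_of_mul_le_mul_right ?_ hy
  linarith

namespace Matrix

variable {n : ℕ}

/-- The value at a real vector of the quadratic form of a complex matrix. -/
def realQuad (M : Matrix (Fin n) (Fin n) ℂ) (v : Fin n → ℝ) : ℂ :=
  ∑ i, ∑ j, (v i : ℂ) * v j * M i j

theorem im_realQuad (M : Matrix (Fin n) (Fin n) ℂ) (v : Fin n → ℝ) :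
    (M.realQuad v).im = v ⬝ᵥ (M.map Complex.im *ᵥ v) := by
  simp only [realQuad, Complex.im_sum, dotProduct, mulVec, Finset.mul_sum, map_apply]
  refine Finset.sum_congr rfl fun i _ => Finset.sum_congr rfl fun j _ => ?_
  rw [← Complex.ofReal_mul, Complex.im_ofReal_mul]
  ring

theorem realQuad_single_add_single (M : Matrix (Fin n) (Fin n) ℂ) (i j : Fin n) :
    M.realQuad (Pi.single i 1 + Pi.single j 1) = M i i + M i j + M j i + M j j := by
  simp [realQuad, Pi.single_apply, apply_ite Complex.ofReal, add_mul, mul_add, Finset.sum_add_distrib]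
  ring

theorem realQuad_single (M : Matrix (Fin n) (Fin n) ℂ) (i : Fin n) :
    M.realQuad (Pi.single i 1) = M i i := by
  simp [realQuad, Pi.single_apply, apply_ite Complex.ofReal]

/-- Polarization; the diagonal case `i = j` is covered as well. -/
theorem IsSymm.norm_apply_le {M : Matrix (Fin n) (Fin n) ℂ} (hM : M.IsSymm) {B : ℝ}
    (hadd : ∀ i j, ‖M.realQuad (Pi.single i 1 + Pi.single j 1)‖ ≤ B)
    (hsingle : ∀ i, ‖M.realQuad (Pi.single i 1)‖ ≤ B) (i j : Fin n) : ‖M i j‖ ≤ 3 * B := by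
  have h : 2 * M i j = M.realQuad (Pi.single i 1 + Pi.single j 1) - M.realQuad (Pi.single i 1)
      - M.realQuad (Pi.single j 1) := by
    rw [realQuad_single_add_single, realQuad_single, realQuad_single, hM.apply i j]
    ring
  have h2 : ‖2 * M i j‖ ≤ B + B + B := by
    rw [h]
    exact (norm_sub_le _ _).trans (add_le_add ((norm_sub_le _ _).trans
      (add_le_add (hadd i j) (hsingle i))) (hsingle j))
  rw [norm_mul, Complex.norm_ofNat] at h2
  linarith [norm_nonneg (M i j)]

/-- The determinant of a real symmetric matrix whose quadratic form is at least `c ≥ 0` on the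
unit sphere is at least `c ^ n`. -/
theorem IsHermitian.pow_le_det {A : Matrix (Fin n) (Fin n) ℝ} (hA : A.IsHermitian) {c : ℝ}
    (hc : 0 ≤ c) (h : ∀ v : EuclideanSpace ℝ (Fin n), ‖v‖ = 1 → c ≤ v.ofLp ⬝ᵥ (A *ᵥ v.ofLp)) :
    c ^ n ≤ A.det := by
  rw [hA.det_eq_prod_eigenvalues]
  calc c ^ n = ∏ _i : Fin n, c := by simp
    _ ≤ _ := Finset.prod_le_prod (fun _ _ => hc) fun i _ => by
      have := h (hA.eigenvectorBasis i) (hA.eigenvectorBasis.orthonormal.1 i)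
      simpa [hA.eigenvalues_eq i] using this

end Matrix

section SiegelFamily

open UpperHalfPlane Complex Matrix

variable {n : ℕ} {G : ℂ → Matrix (Fin n) (Fin n) ℂ}

theorem MatrixHolomorphicOn.differentiableOn_realQuad {U : Set ℂ} (hG : MatrixHolomorphicOn G U)
    (v : Fin n → ℝ) : DifferentiableOn ℂ (fun ω => (G ω).realQuad v) U :=
  DifferentiableOn.fun_sum fun i _ => DifferentiableOn.fun_sum fun j _ => (hG i j).const_mul _

theorem MatrixHolomorphicOn.deriv_realQuad {U : Set ℂ} (hG : MatrixHolomorphicOn G U)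
    (hU : IsOpen U) {ω : ℂ} (hω : ω ∈ U) (v : Fin n → ℝ) :
    deriv (fun ω => (G ω).realQuad v) ω = (matrixDeriv G ω).realQuad v := by
  refine HasDerivAt.deriv ?_
  refine HasDerivAt.fun_sum fun i _ => HasDerivAt.fun_sum fun j _ => ?_
  exact (((hG i j).differentiableAt (hU.mem_nhds hω)).hasDerivAt).const_mul _

theorem im_realQuad_pos_of_mem_siegelUpperHalfSpace {M : Matrix (Fin n) (Fin n) ℂ}
    (hM : M ∈ siegelUpperHalfSpace n) {v : Fin n → ℝ} (hv : v ≠ 0) : 0 < (M.realQuad v).im := by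
  rw [im_realQuad]
  simpa using hM.2.dotProduct_mulVec_pos hv

theorem isSymm_matrixDeriv {U : Set ℂ} (hU : IsOpen U) (hG : ∀ ω ∈ U, (G ω).IsSymm) {ω : ℂ}
    (hω : ω ∈ U) : (matrixDeriv G ω).IsSymm := by
  refine IsSymm.ext fun i j => ?_
  refine Filter.EventuallyEq.deriv_eq ?_
  filter_upwards [hU.mem_nhds hω] with w hw
  exact (hG w hw).apply i j

end SiegelFamily

open UpperHalfPlane hiding I in
open Complex Matrix in
theorem mainTheorem7 (n : ℕ) {K : Type*} [TopologicalSpace K] [CompactSpace K]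
    (F : K → ℂ → Matrix (Fin n) (Fin n) ℂ)
    (hF_mem : ∀ u : K, ∀ ω ∈ UpperHalfPlane.upperHalfPlaneSet, F u ω ∈ siegelUpperHalfSpace n)
    (hF_cont : ContinuousOn (fun p : K × ℂ => F p.1 p.2) (Set.univ ×ˢ UpperHalfPlane.upperHalfPlaneSet))
    (hF_hol : ∀ u : K, MatrixHolomorphicOn (F u) UpperHalfPlane.upperHalfPlaneSet) :
    ∃ C₁ C₂ : ℝ, 0 < C₁ ∧ ∀ u : K, ∀ ω ∈ halfStrip,
      C₁ * ω.im ^ (-(n : ℤ)) ≤ ((F u ω).map Complex.im).det ∧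
      ‖(matrixDeriv (F u) ω).det‖ ≤ C₂ := by
  have hI : I ∈ upperHalfPlaneSet := by simp
  have hcont : Continuous fun u => F u I :=
    hF_cont.comp_continuous (f := fun u : K => (u, I)) (by fun_prop) fun u => ⟨trivial, hI⟩
  have hentry (i j : Fin n) : Continuous fun u => F u I i j := hcont.matrix_elem i j
  have hquad : Continuous fun p : K × EuclideanSpace ℝ (Fin n) =>
      ((F p.1 I).realQuad p.2.ofLp).im := by
    refine Complex.continuous_im.comp ?_
    refine continuous_finsetSum _ fun i _ => continuous_finsetSum _ fun j _ => ?_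
    have := (hentry i j).comp (continuous_fst (X := K) (Y := EuclideanSpace ℝ (Fin n)))
    exact Continuous.mul (by fun_prop) this
  have ne_zero_of_norm {v : EuclideanSpace ℝ (Fin n)} (hv : ‖v‖ = 1) : v.ofLp ≠ 0 := by
    intro h
    rw [(WithLp.ofLp_eq_zero 2).1 h, norm_zero] at hv
    exact zero_ne_one hv
  have hmaps (u : K) {v : Fin n → ℝ} (hv : v ≠ 0) :
      Set.MapsTo (fun ω => (F u ω).realQuad v) upperHalfPlaneSet upperHalfPlaneSet :=
    fun ω hω => im_realQuad_pos_of_mem_siegelUpperHalfSpace (hF_mem u ω hω) hv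
  obtain ⟨c, hc, hcle⟩ := (isCompact_univ.prod
    (isCompact_sphere (0 : EuclideanSpace ℝ (Fin n)) 1)).exists_forall_le' (a := (0 : ℝ))
    (f := fun p : K × EuclideanSpace ℝ (Fin n) => ((F p.1 I).realQuad p.2.ofLp).im)
    hquad.continuousOn fun p hp => hmaps p.1 (ne_zero_of_norm (by simpa using hp.2)) hI
  have hbdd (v : Fin n → ℝ) : ∃ B, ∀ u, ((F u I).realQuad v).im ≤ B := by
    have h : Continuous fun u => ((F u I).realQuad v).im := by
      refine Complex.continuous_im.comp ?_
      exact continuous_finsetSum _ fun i _ => continuous_finsetSum _ fun j _ =>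
        (hentry i j).const_mul _
    obtain ⟨B, hB⟩ := isCompact_univ.bddAbove_image h.continuousOn
    exact ⟨B, fun u => hB ⟨u, trivial, rfl⟩⟩
  choose B hB using hbdd
  -- Polarization needs only finitely many vectors, so bounds depending on `v` suffice.
  obtain ⟨T, hT⟩ := (Set.finite_range fun p : Fin n × Fin n =>
    B (Pi.single p.1 1 + Pi.single p.2 1)).bddAbove
  obtain ⟨S, hS⟩ := (Set.finite_range fun i : Fin n => B (Pi.single i 1)).bddAbove
  -- In `C₂`, the 5 comes from the derivative bound, the 3 from polarization and the factorial from
  -- the Leibniz expansion.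
  refine ⟨(c / 5) ^ n, (Fintype.card (Fin n)).factorial • (3 * (5 * max T S)) ^ Fintype.card (Fin n), by positivity,
    fun u ω hω => ⟨?_, ?_⟩⟩
  · have hy := im_pos_of_mem_halfStrip hω
    rw [_root_.zpow_neg, zpow_natCast, ← inv_pow, ← mul_pow]
    refine (hF_mem u ω hy).2.isHermitian.pow_le_det (by positivity) fun v hv => ?_
    have h1 := im_I_le_of_mem_halfStrip ((hF_hol u).differentiableOn_realQuad v.ofLp)
      (hmaps u (ne_zero_of_norm hv)) hω
    have h2 : c ≤ ((F u I).realQuad v.ofLp).im := hcle (u, v) ⟨trivial, by simpa using hv⟩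
    rw [← im_realQuad, ← div_eq_mul_inv, div_div, div_le_iff₀ (by positivity)]
    linarith
  · have hy := im_pos_of_mem_halfStrip hω
    have hderiv {v : Fin n → ℝ} (hv : v ≠ 0) (hBv : B v ≤ max T S) :
        ‖(matrixDeriv (F u) ω).realQuad v‖ ≤ 5 * max T S := by
      have := norm_deriv_le_of_mem_halfStrip ((hF_hol u).differentiableOn_realQuad v)
        (hmaps u hv) hω
      rw [(hF_hol u).deriv_realQuad isOpen_upperHalfPlaneSet hy] at this
      linarith [hB v u]
    have hle := (isSymm_matrixDeriv isOpen_upperHalfPlaneSet (fun w hw => (hF_mem u w hw).1)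
      hy).norm_apply_le
      (fun i j => hderiv (fun h => by
        have h0 := congrFun h i
        by_cases hij : i = j
        · simp [hij] at h0
        · simp [hij] at h0) ((hT ⟨(i, j), rfl⟩).trans (le_max_left _ _)))
      (fun i => hderiv (by simp) ((hS ⟨i, rfl⟩).trans (le_max_right _ _)))
    exact Matrix.det_le (abv := NormedField.toAbsoluteValue ℂ) hle
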